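/- Let $p$ be a prime, let $m\ge 1$ be an integer, and let $n\ge 1$ be an integer written as $n=Np^t$, where $t\ge 0$ and $N\ge 1$ are integers and $p\nmid N$. A linear code of length $n$ over $\mathbb{F}_{p^m}$ is a linear subspace $C\subseteq\mathbb{F}_{p^m}^n$; it is cyclic if $(c_{n-1},c_0,\dots,c_{n-2})\in C$ for all $(c_0,c_1,\dots,c_{n-1})\in C$, and Euclidean complementary dual if $C\cap C^{\perp_E}=\{0\}$, where $C^{\perp_E}=\{x\in\mathbb{F}_{p^m}^n : \sum_{i=0}^{n-1}x_ic_i=0\text{ for all }c\in C\}$. A positive integer $d$ is called good (with respect to $p^m$ and $1$) if $d\mid p^{mk}+1$ for some integer $k\ge 1$, and bad otherwise. Let $\Phi$ be Euler's totient function and let $\mathrm{ord}_d(p^m)$ be the multiplicative order of $p^m$ modulo $d$. Then the number of Euclidean complementary dual cyclic codes of length $n$ over $\mathbb{F}_{p^m}$ is \[ 2^{\displaystyle \sum_{\substack{d\mid N\\ d\text{ good}}}\frac{\Phi(d)}{\mathrm{ord}_d(p^m)}+\sum_{\substack{d\mid N\\ d\text{ bad}}}\frac{\Phi(d)}{2\,\mathrm{ord}_d(p^m)}}.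 \] -/

import Mathlib

/-- `d` is good with respect to `a` and `b`: it is a positive integer that divides `a ^ k + b ^ k`
for some positive integer `k`. -/
def IsGoodInteger (a b : ℤ) (d : ℕ) : Prop :=
  0 < d ∧ ∃ k : ℕ, 0 < k ∧ (d : ℤ) ∣ a ^ k + b ^ k

/-- The Euclidean dual of a linear code `C` of length `n` over `F`. -/
def euclideanDual {F : Type*} [Field F] {n : ℕ} (C : Submodule F (Fin n → F)) :
    Submodule F (Fin n → F) where
  carrier := {x | ∀ c ∈ C, ∑ i, x i * c i = 0}
  zero_mem' := by
    intro c _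
    simp
  add_mem' := by
    intro x y hx hy c hc
    simp [add_mul, Finset.sum_add_distrib, hx c hc, hy c hc]
  smul_mem' := by
    intro r x hx c hc
    simp [mul_assoc, ← Finset.mul_sum, hx c hc]

/-- `C` is Euclidean complementary dual: it meets its Euclidean dual only in `0`. -/
def IsEuclideanComplementaryDual {F : Type*} [Field F] {n : ℕ}
    (C : Submodule F (Fin n → F)) : Prop :=
  C ⊓ euclideanDual C = ⊥

/-- The cyclic shift `(c₀, c₁, …, cₙ₋₁) ↦ (cₙ₋₁, c₀, …, cₙ₋₂)`. As `finRotate n` is `i ↦ i + 1`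
modulo `n`, the `i`-th entry of the shifted word is the entry of `c` at `i - 1` modulo `n`. -/
def cyclicShift {F : Type*} {n : ℕ} (c : Fin n → F) : Fin n → F :=
  fun i => c ((finRotate n).symm i)

/-- A linear code is cyclic if it is closed under the cyclic shift. -/
def IsCyclicCode {F : Type*} [Field F] {n : ℕ} (C : Submodule F (Fin n → F)) : Prop :=
  ∀ c ∈ C, cyclicShift c ∈ C

/-! Put `q = p ^ m`. Cyclic codes of length `n` are the ideals of the group algebra `F[ℤ/n]`, and
the Euclidean product of `x` and `y` is the coefficient at `0` of `x * σ y`, with `σ` induced by `g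
↦ -g`. For this nondegenerate form, an ideal meets its orthogonal trivially iff a `σ`-fixed
idempotent generates it (`natCard_isLCD_ideal`), so such idempotents are to be counted.

An idempotent equals its own `q ^ t`-th power, hence is supported on the multiples of `p ^ t`, a
copy of `ℤ/N`; this removes the `p`-part of `n` (`natCard_invariant_idempotent_zmod`). Over `ℤ/N`,
the elements fixed by `σ` and by `x ↦ x ^ q` form an algebra isomorphic to a power of `F`, so it has
`2 ^ r` idempotents, `r` being its dimension. Its elements are the functions constant on the orbits
of `⟨q, -1⟩` on `ℤ/N`, so `r` is the number of orbits. An element of order `d` has an orbit of size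
`|⟨q, -1⟩|` in `(ℤ/d)ˣ`, which is `ord_d(q)` for good `d` and twice that for bad `d`. -/

/-! ### Idempotents of algebras on which Frobenius is the identity. -/

theorem natCard_isIdempotentElem_of_field (K : Type*) [Field K] :
    Nat.card {e : K // IsIdempotentElem e} = 2 := by
  have : {e : K | IsIdempotentElem e} = {0, 1} := by
    ext e
    simp [IsIdempotentElem.iff_eq_zero_or_one]
  have h : Nat.card ({e : K | IsIdempotentElem e} : Set K) = 2 := by
    rw [this, Nat.card_coe_set_eq, Set.ncard_pair zero_ne_one]
  exact h

theorem natCard_le_of_forall_pow_eq_self (K : Type*) [Field K] {q : ℕ} (hq : 1 < q)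
    (h : ∀ x : K, x ^ q = x) : Nat.card K ≤ q := by
  classical
  have hne := FiniteField.X_pow_card_sub_X_ne_zero K hq
  set P : Polynomial K := Polynomial.X ^ q - Polynomial.X with hP
  have hsub : (Set.univ : Set K) ⊆ (P.roots.toFinset) := by
    intro x _
    rw [Finset.mem_coe, Multiset.mem_toFinset, Polynomial.mem_roots hne]
    simp [hP, h x]
  calc Nat.card K = (Set.univ : Set K).ncard := (Set.ncard_univ K).symm
    _ ≤ (P.roots.toFinset : Set K).ncard :=
      Set.ncard_le_ncard hsub (Finset.finite_toSet _)
    _ = P.roots.toFinset.card :=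
      Set.ncard_coe_finset _
    _ ≤ P.roots.card :=
      Multiset.toFinset_card_le _
    _ ≤ P.natDegree := Polynomial.card_roots' _
    _ = q := FiniteField.X_pow_card_sub_X_natDegree_eq K hq

/-- Such a `B` is reduced and Artinian, hence a product of its residue fields. Each has exactly `q`
elements: it contains `F` and consists of roots of `X ^ q - X`. Comparing cardinalities, the number
of factors is the dimension, and each factor has the two idempotents `0` and `1`. -/
theorem natCard_isIdempotentElem_of_forall_pow_eq_self (F B : Type*) [Field F] [Finite F]
    [CommRing B] [Algebra F B] [Finite B] (h : ∀ x : B, x ^ Nat.card F = x) :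
    Nat.card {e : B // IsIdempotentElem e} = 2 ^ Module.finrank F B := by
  have hq : 1 < Nat.card F := Finite.one_lt_card
  have : IsReduced B := by
    refine ⟨fun x hx => ?_⟩
    obtain ⟨k, hk⟩ := hx
    have hpow : ∀ j, x ^ Nat.card F ^ j = x := by
      intro j
      induction j with
      | zero => simp
      | succ j ih => rw [pow_succ, pow_mul, ih, h]
    rw [← hpow k]
    exact pow_eq_zero_of_le (Nat.lt_pow_self hq).le hk
  have hfield : ∀ I : MaximalSpectrum B, Nat.card (B ⧸ I.asIdeal) = Nat.card F := by
    intro I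
    have := I.isMaximal
    apply le_antisymm
    · let := Ideal.Quotient.field I.asIdeal
      apply natCard_le_of_forall_pow_eq_self _ hq
      intro x
      obtain ⟨y, rfl⟩ := Ideal.Quotient.mk_surjective x
      rw [← map_pow, h]
    · have : Finite (B ⧸ I.asIdeal) := Finite.of_surjective _ Ideal.Quotient.mk_surjective
      exact Nat.card_le_card_of_injective _ (algebraMap F (B ⧸ I.asIdeal)).injective
  have hfin : Finite (MaximalSpectrum B) := inferInstance
  have : Fintype (MaximalSpectrum B) := Fintype.ofFinite _
  have e := IsArtinianRing.equivPi B
  have hcard : Nat.card F ^ Module.finrank F B = Nat.card F ^ Nat.card (MaximalSpectrum B) := by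
    rw [← Module.natCard_eq_pow_finrank, Nat.card_congr e.toEquiv, Nat.card_pi]
    simp [hfield]
  have hrank := Nat.pow_right_injective hq hcard
  rw [hrank]
  have e2 : {e : B // IsIdempotentElem e} ≃
      ((I : MaximalSpectrum B) → {e : B ⧸ I.asIdeal // IsIdempotentElem e}) :=
    (e.toEquiv.subtypeEquiv (q := fun f => ∀ I, IsIdempotentElem (f I)) (by
      intro a
      have : (∀ I, IsIdempotentElem (e a I)) ↔ e a * e a = e a := funext_iff.symm
      refine Iff.trans ?_ this.symm
      change a * a = a ↔ e a * e a = e a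
      rw [← map_mul, e.injective.eq_iff])).trans Equiv.subtypePiEquivPi
  rw [Nat.card_congr e2, Nat.card_pi]
  have h2 : ∀ I : MaximalSpectrum B, Nat.card {e : B ⧸ I.asIdeal // IsIdempotentElem e} = 2 := by
    intro I
    have := I.isMaximal
    let := Ideal.Quotient.field I.asIdeal
    exact natCard_isIdempotentElem_of_field _
  simp only [h2, Finset.prod_const, Finset.card_univ, Nat.card_eq_fintype_card]

/-! ### Ideals meeting their orthogonal trivially, for the form `l (x * σ y)`. -/

section InvolutiveFrobeniusAlgebra

variable {F A : Type*} [Field F] [CommRing A] [Algebra F A]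

/-- The bilinear form `(x, y) ↦ l (x * σ y)`. -/
def twistedTraceForm (l : A →ₗ[F] F) (σ : A →ₐ[F] A) : LinearMap.BilinForm F A :=
  LinearMap.mk₂ F (fun x y => l (x * σ y)) (fun x x' y => by simp [add_mul])
    (fun c x y => by simp) (fun x y y' => by simp [mul_add]) (fun c x y => by simp)

theorem twistedTraceForm_apply (l : A →ₗ[F] F) (σ : A →ₐ[F] A) (x y : A) :
    twistedTraceForm l σ x y = l (x * σ y) := rfl

variable {l : A →ₗ[F] F} {σ : A →ₐ[F] A}

theorem twistedTraceForm_isRefl (hσ : ∀ x, σ (σ x) = x) (hl : ∀ x, l (σ x) = l x) :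
    (twistedTraceForm l σ).IsRefl := by
  intro x y h
  rw [twistedTraceForm_apply] at h ⊢
  rw [← hl, map_mul, hσ, mul_comm, h]

/-- Since `I` is an ideal, orthogonality upgrades from `l (x * σ c) = 0` to `x * σ c = 0`: test
against `σ y * c` and use nondegeneracy. -/
theorem mul_apply_eq_zero_of_orthogonal (hl0 : ∀ x, (∀ y, l (x * y) = 0) → x = 0)
    (hσ : ∀ x, σ (σ x) = x) {I : Ideal A} {x c : A} (hc : c ∈ I)
    (hx : ∀ c ∈ I, l (x * σ c) = 0) : x * σ c = 0 := by
  apply hl0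
  intro y
  have := hx (σ y * c) (I.mul_mem_left _ hc)
  rw [map_mul σ, hσ] at this
  rw [← this]
  congr 1
  ring

theorem isLCD_span_idempotent (hl0 : ∀ x, (∀ y, l (x * y) = 0) → x = 0)
    (hσ : ∀ x, σ (σ x) = x) {e : A} (he : IsIdempotentElem e) (hs : σ e = e) {x : A}
    (hx : x ∈ Ideal.span {e}) (h : ∀ c ∈ Ideal.span {e}, l (x * σ c) = 0) : x = 0 := by
  have h0 := mul_apply_eq_zero_of_orthogonal hl0 hσ (Ideal.mem_span_singleton_self e) h
  obtain ⟨y, rfl⟩ := Ideal.mem_span_singleton'.1 hx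
  rwa [hs, mul_assoc, he] at h0

theorem exists_idempotent_of_isLCD [FiniteDimensional F A]
    (hl0 : ∀ x, (∀ y, l (x * y) = 0) → x = 0)
    (hσ : ∀ x, σ (σ x) = x) (hl : ∀ x, l (σ x) = l x) {I : Ideal A}
    (h : ∀ x ∈ I, (∀ c ∈ I, l (x * σ c) = 0) → x = 0) :
    ∃ e, IsIdempotentElem e ∧ σ e = e ∧ Ideal.span {e} = I := by
  have href := twistedTraceForm_isRefl (l := l) hσ hl
  let W : Submodule F A := I.restrictScalars F
  have hmem : ∀ x, x ∈ (twistedTraceForm l σ).orthogonal W ↔ ∀ c ∈ I, l (x * σ c) = 0 := by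
    intro x
    refine forall₂_congr fun c hc => ?_
    exact ⟨href c x, href x c⟩
  have hd : Disjoint W ((twistedTraceForm l σ).orthogonal W) := by
    rw [Submodule.disjoint_def]
    intro x hx hx'
    exact h x hx ((hmem x).1 hx')
  have hc := (LinearMap.BilinForm.isCompl_orthogonal_iff_disjoint href).2 hd
  have h1 : (1 : A) ∈ W ⊔ (twistedTraceForm l σ).orthogonal W := by
    rw [hc.sup_eq_top]; trivial
  -- The generator is the component in `I` of `1 = e + f`.
  obtain ⟨e, heI, f, hf, hef⟩ := Submodule.mem_sup.1 h1
  replace heI : e ∈ I := heI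
  rw [hmem] at hf
  -- `x * f` lies in `I` and is orthogonal to `I`, because `f * σ c = 0` for `c ∈ I`.
  have hI : ∀ x ∈ I, x * f = 0 := by
    intro x hx
    apply h _ (I.mul_mem_right _ hx)
    intro c hc
    rw [mul_assoc, mul_apply_eq_zero_of_orthogonal hl0 hσ hc hf, mul_zero, map_zero]
  have hxe : ∀ x ∈ I, x * e = x := by
    intro x hx
    have := hI x hx
    rw [← eq_sub_iff_add_eq'] at hef
    rw [hef] at this
    linear_combination -this
  -- This is `f * σ e = 0`; its right side is `σ`-invariant, which will give `σ e = e`.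
  have hs : σ e = e * σ e := by
    have := mul_apply_eq_zero_of_orthogonal hl0 hσ heI hf
    rw [← eq_sub_iff_add_eq'] at hef
    rw [hef] at this
    linear_combination this
  refine ⟨e, hxe e heI, ?_, ?_⟩
  · have h2 := congrArg σ hs
    rw [map_mul, hσ, mul_comm, ← hs] at h2
    exact h2.symm
  · apply le_antisymm
    · rwa [Ideal.span_singleton_le_iff_mem]
    · intro x hx
      exact Ideal.mem_span_singleton'.2 ⟨x, hxe x hx⟩

/-- Over an algebra with a nondegenerate form `l (x * σ y)`, the ideals meeting their orthogonal
trivially are exactly those generated by a `σ`-invariant idempotent. -/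
theorem natCard_isLCD_ideal [FiniteDimensional F A]
    (hl0 : ∀ x, (∀ y, l (x * y) = 0) → x = 0)
    (hσ : ∀ x, σ (σ x) = x) (hl : ∀ x, l (σ x) = l x) :
    Nat.card {I : Ideal A // ∀ x ∈ I, (∀ c ∈ I, l (x * σ c) = 0) → x = 0} =
      Nat.card {e : A // IsIdempotentElem e ∧ σ e = e} := by
  symm
  refine Nat.card_congr (Equiv.ofBijective (fun e => ⟨Ideal.span {e.1}, fun x hx h =>
    isLCD_span_idempotent hl0 hσ e.2.1 e.2.2 hx h⟩) ⟨?_, ?_⟩)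
  · rintro ⟨e, he, hse⟩ ⟨f, hf, hsf⟩ hef
    have hef : Ideal.span {e} = Ideal.span {f} := congrArg Subtype.val hef
    obtain ⟨a, ha⟩ := Ideal.mem_span_singleton'.1 (hef ▸ Ideal.mem_span_singleton_self e)
    obtain ⟨b, hb⟩ := Ideal.mem_span_singleton'.1 (hef ▸ Ideal.mem_span_singleton_self f)
    have h1 : e * f = e := by rw [← ha, mul_assoc, hf]
    have h2 : f * e = f := by rw [← hb, mul_assoc, he]
    exact Subtype.ext (h1.symm.trans ((mul_comm e f).trans h2))
  · rintro ⟨I, hI⟩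
    obtain ⟨e, he, hs, h⟩ := exists_idempotent_of_isLCD hl0 hσ hl hI
    exact ⟨⟨e, he, hs⟩, Subtype.ext h⟩

end InvolutiveFrobeniusAlgebra

/-! ### The inversion and the coefficient form on the group algebra. -/

section GroupAlgebra

variable (F : Type*) [Field F] {G H : Type*} [AddCommGroup G] [AddCommGroup H]

/-- The involution of the group algebra induced by `g ↦ -g`. -/
noncomputable def groupAlgebraInversion (G : Type*) [AddCommGroup G] :
    AddMonoidAlgebra F G →ₐ[F] AddMonoidAlgebra F G :=
  AddMonoidAlgebra.mapDomainAlgHom F F (negAddMonoidHom : G →+ G)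

variable {F}

theorem coeff_mapDomainAlgHom_of_injective (f : G →+ H) (hf : Function.Injective f)
    (x : AddMonoidAlgebra F G) (g : G) :
    (AddMonoidAlgebra.mapDomainAlgHom F F f x).coeff (f g) = x.coeff g := by
  simp [AddMonoidAlgebra.mapDomain, Finsupp.mapDomain_apply hf]

theorem groupAlgebraInversion_coeff (x : AddMonoidAlgebra F G) (g : G) :
    (groupAlgebraInversion F G x).coeff g = x.coeff (-g) := by
  have := coeff_mapDomainAlgHom_of_injective (negAddMonoidHom : G →+ G) neg_injective x (-g)
  simpa [groupAlgebraInversion] using this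

theorem groupAlgebraInversion_involutive (x : AddMonoidAlgebra F G) :
    groupAlgebraInversion F G (groupAlgebraInversion F G x) = x := by
  ext g
  simp [groupAlgebraInversion_coeff]

variable (F G) in
/-- The coefficient at `0` of an element of the group algebra. -/
noncomputable def groupAlgebraCoeffZero : AddMonoidAlgebra F G →ₗ[F] F :=
  Finsupp.lapply (0 : G) ∘ₗ (AddMonoidAlgebra.coeffLinearEquiv F).toLinearMap

theorem groupAlgebraCoeffZero_apply (x : AddMonoidAlgebra F G) :
    groupAlgebraCoeffZero F G x = x.coeff 0 := rfl

theorem groupAlgebraCoeffZero_inversion (x : AddMonoidAlgebra F G) :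
    groupAlgebraCoeffZero F G (groupAlgebraInversion F G x) = groupAlgebraCoeffZero F G x := by
  simp [groupAlgebraCoeffZero_apply, groupAlgebraInversion_coeff]

theorem groupAlgebraCoeffZero_mul_inversion [Fintype G] (x y : AddMonoidAlgebra F G) :
    groupAlgebraCoeffZero F G (x * groupAlgebraInversion F G y) =
      ∑ g, x.coeff g * y.coeff g := by
  rw [groupAlgebraCoeffZero_apply, AddMonoidAlgebra.coeff_mul_apply_left,
    Finsupp.sum_fintype _ _ (by simp)]
  simp [groupAlgebraInversion_coeff]

theorem groupAlgebraCoeffZero_nondegenerate (x : AddMonoidAlgebra F G)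
    (h : ∀ y, groupAlgebraCoeffZero F G (x * y) = 0) : x = 0 := by
  ext g
  have := h (AddMonoidAlgebra.single (-g) 1)
  simpa [groupAlgebraCoeffZero_apply] using this

end GroupAlgebra

/-! ### Cyclic codes as ideals of the group algebra. -/

section CyclicCode

variable {F : Type*} [Field F] {k : ℕ}

variable (F k) in
/-- Words of length `k + 1` as elements of the group algebra of `Fin (k + 1)`. -/
noncomputable def wordEquiv : (Fin (k + 1) → F) ≃ₗ[F] AddMonoidAlgebra F (Fin (k + 1)) :=
  (Finsupp.linearEquivFunOnFinite F F (Fin (k + 1))).symm ≪≫ₗ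
    (AddMonoidAlgebra.coeffLinearEquiv F).symm

theorem wordEquiv_coeff (c : Fin (k + 1) → F) (i : Fin (k + 1)) :
    (wordEquiv F k c).coeff i = c i := rfl

theorem wordEquiv_cyclicShift (c : Fin (k + 1) → F) :
    wordEquiv F k (cyclicShift c) = AddMonoidAlgebra.single 1 1 * wordEquiv F k c := by
  ext i
  have : (finRotate (k + 1)).symm i = -1 + i := by
    rw [Equiv.symm_apply_eq]
    simp
  simp [wordEquiv_coeff, cyclicShift, this]

theorem IsCyclicCode.mul_mem {C : Submodule F (Fin (k + 1) → F)} (hC : IsCyclicCode C)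
    (a : AddMonoidAlgebra F (Fin (k + 1))) {c : Fin (k + 1) → F} (hc : c ∈ C) :
    (wordEquiv F k).symm (a * wordEquiv F k c) ∈ C := by
  have hs : ∀ g : Fin (k + 1), (wordEquiv F k).symm
      (AddMonoidAlgebra.single g 1 * wordEquiv F k c) ∈ C := by
    intro g
    induction g using Fin.induction with
    | zero => simpa [← AddMonoidAlgebra.one_def] using hc
    | succ j ih =>
      have := hC _ ih
      rw [← LinearEquiv.symm_apply_apply (wordEquiv F k) (cyclicShift _), wordEquiv_cyclicShift,
        LinearEquiv.apply_symm_apply, ← mul_assoc, AddMonoidAlgebra.single_mul_single,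
        add_comm (1 : Fin (k + 1)) j.castSucc, Fin.coeSucc_eq_succ, one_mul] at this
      exact this
  induction a using AddMonoidAlgebra.induction_linear with
  | zero => simp
  | add x y hx hy => rw [add_mul, map_add]; exact C.add_mem hx hy
  | single g r =>
    have h1 := C.smul_mem r (hs g)
    rw [← map_smul, ← smul_mul_assoc, AddMonoidAlgebra.smul_single] at h1
    simpa using h1

theorem isEuclideanComplementaryDual_iff {n : ℕ} (C : Submodule F (Fin n → F)) :
    IsEuclideanComplementaryDual C ↔
      ∀ x ∈ C, (∀ c ∈ C, ∑ i, x i * c i = 0) → x = 0 := by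
  rw [IsEuclideanComplementaryDual, ← disjoint_iff, Submodule.disjoint_def]
  rfl

variable (F k) in
/-- The cyclic codes of length `k + 1` meeting their dual trivially, as ideals. -/
noncomputable def lcdCyclicCodeEquiv :
    {C : Submodule F (Fin (k + 1) → F) | IsCyclicCode C ∧ IsEuclideanComplementaryDual C} ≃
    {I : Ideal (AddMonoidAlgebra F (Fin (k + 1))) // ∀ x ∈ I, (∀ c ∈ I,
      groupAlgebraCoeffZero F _ (x * groupAlgebraInversion F _ c) = 0) → x = 0} where
  toFun C := ⟨{ C.1.map (wordEquiv F k).toLinearMap with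
      smul_mem' := by
        rintro a _ ⟨c, hc, rfl⟩
        exact ⟨_, C.2.1.mul_mem a hc, by simp⟩ }, by
    rintro _ ⟨x, hx, rfl⟩ h
    have h0 := (isEuclideanComplementaryDual_iff C.1).1 C.2.2 x hx (by
      intro c hc
      have := h _ ⟨c, hc, rfl⟩
      rwa [groupAlgebraCoeffZero_mul_inversion] at this)
    simp [h0]⟩
  invFun I := ⟨(I.1.restrictScalars F).comap (wordEquiv F k).toLinearMap, by
    constructor
    · intro c hc
      change wordEquiv F k (cyclicShift c) ∈ I.1
      rw [wordEquiv_cyclicShift]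
      exact I.1.mul_mem_left _ hc
    · rw [isEuclideanComplementaryDual_iff]
      intro x hx h
      have h0 := I.2 _ hx (by
        intro c hc
        rw [groupAlgebraCoeffZero_mul_inversion]
        exact h ((wordEquiv F k).symm c) (by
          change wordEquiv F k ((wordEquiv F k).symm c) ∈ I.1
          rwa [LinearEquiv.apply_symm_apply]))
      simpa using h0⟩
  left_inv C := by
    apply Subtype.ext
    exact Submodule.comap_map_eq_of_injective (wordEquiv F k).injective _
  right_inv I := by
    apply Subtype.ext
    ext x
    change x ∈ Submodule.map _ (Submodule.comap _ (I.1.restrictScalars F)) ↔ _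
    rw [Submodule.map_comap_eq_of_surjective (wordEquiv F k).surjective]
    rfl

theorem ncard_lcdCyclicCode :
    Set.ncard {C : Submodule F (Fin (k + 1) → F) |
      IsCyclicCode C ∧ IsEuclideanComplementaryDual C} =
    Nat.card {e : AddMonoidAlgebra F (Fin (k + 1)) //
      IsIdempotentElem e ∧ groupAlgebraInversion F _ e = e} := by
  have : FiniteDimensional F (AddMonoidAlgebra F (Fin (k + 1))) :=
    Module.Finite.equiv (wordEquiv F k)
  rw [← Nat.card_coe_set_eq, Nat.card_congr (lcdCyclicCodeEquiv F k)]
  exact natCard_isLCD_ideal groupAlgebraCoeffZero_nondegenerate groupAlgebraInversion_involutive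
    groupAlgebraCoeffZero_inversion

end CyclicCode

/-! ### Frobenius on the group algebra and removal of the `p`-part of the length. -/

section Frobenius

variable {F : Type*} [Field F] {G H : Type*} [AddCommGroup G] [AddCommGroup H]

theorem charP_of_natCard_eq_prime_pow {p m : ℕ} (hp : p.Prime)
    (hF : Nat.card F = p ^ m) : CharP F p := by
  have : Finite F := Nat.finite_of_card_ne_zero (by rw [hF]; exact (pow_pos hp.pos m).ne')
  have := Fintype.ofFinite F
  have : Fact p.Prime := ⟨hp⟩
  rw [Nat.card_eq_fintype_card] at hF
  exact charP_of_card_eq_prime_pow hF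

/-- In the group algebra over a field with `q` elements, raising to the power `q ^ s` multiplies
the exponents by `q ^ s`. -/
theorem groupAlgebra_pow_card_pow {p m : ℕ} (hp : p.Prime)
    (hF : Nat.card F = p ^ m) (s : ℕ) (x : AddMonoidAlgebra F G) :
    x ^ ((p ^ m) ^ s) =
      AddMonoidAlgebra.mapDomainAlgHom F F (nsmulAddMonoidHom ((p ^ m) ^ s) : G →+ G) x := by
  have : CharP F p := charP_of_natCard_eq_prime_pow hp hF
  have : CharP (AddMonoidAlgebra F G) p := charP_of_injective_algebraMap' F p
  have : ExpChar (AddMonoidAlgebra F G) p := ExpChar.prime hp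
  have hfin : Finite F := Nat.finite_of_card_ne_zero (by rw [hF]; exact (pow_pos hp.pos m).ne')
  have := Fintype.ofFinite F
  have hr : ∀ r : F, r ^ ((p ^ m) ^ s) = r := by
    intro r
    rw [← hF, Nat.card_eq_fintype_card]
    exact FiniteField.pow_card_pow s r
  induction x using AddMonoidAlgebra.induction_linear with
  | zero => rw [map_zero, zero_pow (pow_pos (pow_pos hp.pos m) s).ne']
  | add x y hx hy =>
    rw [map_add, ← hx, ← hy, ← pow_mul]
    exact add_pow_expChar_pow x y p (m * s)
  | single g r => simp [AddMonoidAlgebra.single_pow, hr]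

theorem mapDomainAlgHom_groupAlgebraInversion (f : G →+ H) (x : AddMonoidAlgebra F G) :
    AddMonoidAlgebra.mapDomainAlgHom F F f (groupAlgebraInversion F G x) =
      groupAlgebraInversion F H (AddMonoidAlgebra.mapDomainAlgHom F F f x) := by
  induction x using AddMonoidAlgebra.induction_linear with
  | zero => simp
  | add x y hx hy => simp only [map_add, hx, hy]
  | single g r => simp [groupAlgebraInversion]

/-- If multiplication by `q ^ s` on `G` factors through an injection `H → G`, then the
inversion-invariant idempotents of the group algebra of `G` come from that of `H`. -/
theorem natCard_invariant_idempotent_eq_of_factor {p m : ℕ} (hp : p.Prime)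
    (hF : Nat.card F = p ^ m) (s : ℕ) (f : H →+ G) (hf : Function.Injective f) (g : G →+ H)
    (hfg : ∀ a, f (g a) = (p ^ m) ^ s • a) :
    Nat.card {e : AddMonoidAlgebra F G // IsIdempotentElem e ∧ groupAlgebraInversion F G e = e} =
    Nat.card {e : AddMonoidAlgebra F H // IsIdempotentElem e ∧ groupAlgebraInversion F H e = e} := by
  have hinj : Function.Injective (AddMonoidAlgebra.mapDomainAlgHom F F f) := by
    intro x y hxy
    ext a
    rw [← coeff_mapDomainAlgHom_of_injective f hf x, hxy, coeff_mapDomainAlgHom_of_injective f hf]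
  symm
  refine Nat.card_congr (Equiv.ofBijective
    (fun e => ⟨AddMonoidAlgebra.mapDomainAlgHom F F f e.1, e.2.1.map _, by
      rw [← mapDomainAlgHom_groupAlgebraInversion, e.2.2]⟩) ⟨?_, ?_⟩)
  · intro x y hxy
    exact Subtype.ext (hinj (congrArg Subtype.val hxy))
  · rintro ⟨e, he, hs⟩
    have hpow : e ^ ((p ^ m) ^ s) = e := by
      obtain ⟨j, hj⟩ := Nat.exists_eq_succ_of_ne_zero (pow_pos (pow_pos hp.pos m) s).ne'
      rw [hj]
      exact he.pow_succ_eq j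
    have he' : AddMonoidAlgebra.mapDomainAlgHom F F f
        (AddMonoidAlgebra.mapDomainAlgHom F F g e) = e := by
      conv_rhs => rw [← hpow, groupAlgebra_pow_card_pow hp hF]
      rw [← AlgHom.comp_apply, ← AddMonoidAlgebra.mapDomainAlgHom_comp]
      congr 2
      ext a
      exact hfg a
    refine ⟨⟨AddMonoidAlgebra.mapDomainAlgHom F F g e, he.map _, ?_⟩, Subtype.ext he'⟩
    rw [← mapDomainAlgHom_groupAlgebraInversion, hs]

theorem natCard_invariant_idempotent_zmod {p m n N t : ℕ} (hp : p.Prime) (hm : 0 < m)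
    (hF : Nat.card F = p ^ m) (hn : 0 < n) (hnN : n = N * p ^ t) :
    Nat.card {e : AddMonoidAlgebra F (ZMod n) //
      IsIdempotentElem e ∧ groupAlgebraInversion F (ZMod n) e = e} =
    Nat.card {e : AddMonoidAlgebra F (ZMod N) //
      IsIdempotentElem e ∧ groupAlgebraInversion F (ZMod N) e = e} := by
  have hN : N ∣ n := ⟨_, hnN⟩
  have hpt : p ^ t ≠ 0 := (pow_pos hp.pos t).ne'
  -- As `m ≥ 1`, multiplication by `q ^ t = p ^ t * c` on `ℤ/n` factors as reduction modulo `N`,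
  -- then multiplication by `c`, then the embedding `1 ↦ p ^ t`.
  obtain ⟨c, hc⟩ : p ^ t ∣ (p ^ m) ^ t := by
    rw [← pow_mul]
    exact pow_dvd_pow p (Nat.le_mul_of_pos_left t hm)
  have : NeZero n := ⟨hn.ne'⟩
  have hf0 : (zmultiplesHom (ZMod n) ((p ^ t : ℕ) : ZMod n)) (N : ℤ) = 0 := by
    simp only [zmultiplesHom_apply, zsmul_eq_mul, Int.cast_natCast]
    rw [← Nat.cast_mul, ← hnN, ZMod.natCast_self]
  let f : ZMod N →+ ZMod n := ZMod.lift N ⟨zmultiplesHom (ZMod n) ((p ^ t : ℕ) : ZMod n), hf0⟩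
  have hfz : ∀ z : ℤ, f (z : ZMod N) = ((z * (p ^ t : ℕ) : ℤ) : ZMod n) := by
    intro z
    simp [f]
  refine natCard_invariant_idempotent_eq_of_factor hp hF t f ?_
    ((nsmulAddMonoidHom c).comp (ZMod.castHom hN (ZMod N)).toAddMonoidHom) ?_
  · rw [injective_iff_map_eq_zero]
    intro a ha
    obtain ⟨z, rfl⟩ := ZMod.intCast_surjective a
    rw [hfz, ZMod.intCast_zmod_eq_zero_iff_dvd, hnN] at ha
    rw [ZMod.intCast_zmod_eq_zero_iff_dvd]
    push_cast at ha
    exact Int.dvd_of_mul_dvd_mul_right (by exact_mod_cast hpt) ha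
  · intro a
    obtain ⟨z, rfl⟩ := ZMod.intCast_surjective a
    have : ((nsmulAddMonoidHom c).comp (ZMod.castHom hN (ZMod N)).toAddMonoidHom) (z : ZMod n) =
        ((c * z : ℤ) : ZMod N) := by simp
    rw [this, hfz, hc]
    simp
    ring

end Frobenius

/-! ### The fixed algebra and the orbits of `⟨q, -1⟩` on `ℤ/N`. -/

section Orbits

variable {F : Type*} [Field F]

/-- The group of units modulo `N` generated by `q` and `-1`. -/
def signedPowers {q N : ℕ} (h : q.Coprime N) : Subgroup (ZMod N)ˣ :=
  Subgroup.zpowers (ZMod.unitOfCoprime q h) ⊔ Subgroup.zpowers (-1)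

/-- The elements of the group algebra fixed by the Frobenius and by the inversion. -/
noncomputable def frobeniusInversionFixed (F : Type*) [Field F] (q : ℕ) (G : Type*)
    [AddCommGroup G] :
    Subalgebra F (AddMonoidAlgebra F G) :=
  AlgHom.equalizer
    (AddMonoidAlgebra.mapDomainAlgHom F F (nsmulAddMonoidHom q : G →+ G)) (AlgHom.id F _) ⊓
  AlgHom.equalizer (groupAlgebraInversion F G) (AlgHom.id F _)

theorem mem_frobeniusInversionFixed {p m : ℕ} (hp : p.Prime)
    (hF : Nat.card F = p ^ m) {G : Type*} [AddCommGroup G] (x : AddMonoidAlgebra F G) :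
    x ∈ frobeniusInversionFixed F (p ^ m) G ↔
      x ^ (p ^ m) = x ∧ groupAlgebraInversion F G x = x := by
  have := groupAlgebra_pow_card_pow hp hF 1 x
  rw [pow_one] at this
  rw [this]
  rfl

theorem mem_frobeniusInversionFixed_iff_orbit {p m N : ℕ} [NeZero N] (h : (p ^ m).Coprime N) (x : AddMonoidAlgebra F (ZMod N)) :
    x ∈ frobeniusInversionFixed F (p ^ m) (ZMod N) ↔
      ∀ u ∈ signedPowers h, ∀ a, x.coeff ((u : ZMod N) * a) = x.coeff a := by
  have hinj : Function.Injective (nsmulAddMonoidHom (p ^ m) : ZMod N →+ ZMod N) := by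
    intro a b hab
    simp only [nsmulAddMonoidHom_apply, nsmul_eq_mul] at hab
    rw [← ZMod.coe_unitOfCoprime _ h] at hab
    exact (Units.mul_right_inj _).1 hab
  have h1 : x ∈ frobeniusInversionFixed F (p ^ m) (ZMod N) ↔
      (∀ a, x.coeff (((p ^ m : ℕ) : ZMod N) * a) = x.coeff a) ∧ ∀ a, x.coeff (-a) = x.coeff a := by
    refine and_congr ⟨fun hx a => ?_, fun hx => ?_⟩ ⟨fun hx a => ?_, fun hx => ?_⟩
    · have := coeff_mapDomainAlgHom_of_injective _ hinj x a
      rw [show AddMonoidAlgebra.mapDomainAlgHom F F _ x = x from hx] at this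
      simpa using this
    · refine AddMonoidAlgebra.ext (Finsupp.ext fun b => ?_)
      obtain ⟨a, rfl⟩ := Finite.surjective_of_injective hinj b
      refine (coeff_mapDomainAlgHom_of_injective _ hinj x a).trans ?_
      rw [← hx a]
      simp
    · have := groupAlgebraInversion_coeff x a
      rw [show groupAlgebraInversion F _ x = x from hx] at this
      exact this.symm
    · refine AddMonoidAlgebra.ext (Finsupp.ext fun b => ?_)
      exact (groupAlgebraInversion_coeff x b).trans (hx b)
  rw [h1]
  constructor
  · rintro ⟨hq, hneg⟩
    let K : Subgroup (ZMod N)ˣ :=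
      { carrier := {u | ∀ a, x.coeff ((u : ZMod N) * a) = x.coeff a}
        one_mem' := by simp
        mul_mem' := by
          intro u v hu hv a
          rw [Units.val_mul, mul_assoc, hu, hv]
        inv_mem' := by
          intro u hu a
          rw [← hu, Units.mul_inv_cancel_left] }
    have hK : signedPowers h ≤ K := by
      refine sup_le ?_ ?_
      · rw [Subgroup.zpowers_le]
        intro a
        rw [ZMod.coe_unitOfCoprime]
        exact hq a
      · rw [Subgroup.zpowers_le]
        intro a
        simpa using hneg a
    exact fun u hu => hK hu
  · intro hu
    refine ⟨fun a => ?_, fun a => ?_⟩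
    · rw [← ZMod.coe_unitOfCoprime _ h]
      exact hu _ (Subgroup.mem_sup_left (Subgroup.mem_zpowers _)) a
    · have := hu (-1) (Subgroup.mem_sup_right (Subgroup.mem_zpowers _)) a
      simpa using this

theorem finrank_frobeniusInversionFixed (F : Type*) [Field F] {p m N : ℕ} [NeZero N]
    (h : (p ^ m).Coprime N) :
    Module.finrank F (frobeniusInversionFixed F (p ^ m) (ZMod N)) =
      Nat.card (MulAction.orbitRel.Quotient (signedPowers h) (ZMod N)) := by
  let Ω := MulAction.orbitRel.Quotient (signedPowers h) (ZMod N)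
  have : Fintype Ω := Fintype.ofFinite _
  let π : ZMod N → Ω := Quotient.mk _
  let L : (Ω → F) →ₗ[F] AddMonoidAlgebra F (ZMod N) :=
    ((Finsupp.linearEquivFunOnFinite F F (ZMod N)).symm ≪≫ₗ
      (AddMonoidAlgebra.coeffLinearEquiv F).symm).toLinearMap ∘ₗ LinearMap.funLeft F F π
  have hL : ∀ φ a, (L φ).coeff a = φ (π a) := fun φ a => rfl
  have hLinj : Function.Injective L := by
    intro φ ψ hφψ
    ext ω
    obtain ⟨a, rfl⟩ := Quotient.exists_rep ω
    have := congrArg (fun y => y.coeff a) hφψ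
    simpa only [hL] using this
  have hrange : LinearMap.range L =
      Subalgebra.toSubmodule (frobeniusInversionFixed F (p ^ m) (ZMod N)) := by
    ext x
    rw [Subalgebra.mem_toSubmodule, mem_frobeniusInversionFixed_iff_orbit h]
    constructor
    · rintro ⟨φ, rfl⟩ u hu a
      rw [hL, hL]
      congr 1
      exact Quotient.sound ⟨⟨u, hu⟩, rfl⟩
    · intro hx
      refine ⟨fun ω => Quotient.lift (fun a => x.coeff a) ?_ ω, ?_⟩
      · rintro a b ⟨u, rfl⟩
        exact hx u.1 u.2 b
      · ext a
        rfl
  have := LinearMap.finrank_range_of_inj hLinj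
  rw [hrange] at this
  rw [Nat.card_eq_fintype_card]
  refine Eq.trans ?_ (this.trans (Module.finrank_fintype_fun_eq_card F))
  rfl

theorem natCard_invariant_idempotent_eq_two_pow {p m N : ℕ} [NeZero N] (hp : p.Prime)
    (hF : Nat.card F = p ^ m) (h : (p ^ m).Coprime N) :
    Nat.card {e : AddMonoidAlgebra F (ZMod N) //
      IsIdempotentElem e ∧ groupAlgebraInversion F (ZMod N) e = e} =
    2 ^ Nat.card (MulAction.orbitRel.Quotient (signedPowers h) (ZMod N)) := by
  have : Finite F := Nat.finite_of_card_ne_zero (by rw [hF]; exact (pow_pos hp.pos m).ne')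
  have : Finite (AddMonoidAlgebra F (ZMod N)) :=
    Finite.of_equiv _ ((Finsupp.linearEquivFunOnFinite F F (ZMod N)).symm ≪≫ₗ
      (AddMonoidAlgebra.coeffLinearEquiv F).symm).toEquiv
  rw [← finrank_frobeniusInversionFixed F h,
    ← natCard_isIdempotentElem_of_forall_pow_eq_self F]
  · refine Nat.card_congr ⟨fun e => ⟨⟨e.1, ?_⟩, ?_⟩, fun e => ⟨e.1.1, ?_, ?_⟩,
      fun _ => rfl, fun _ => rfl⟩
    · rw [mem_frobeniusInversionFixed hp hF]
      refine ⟨?_, e.2.2⟩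
      obtain ⟨j, hj⟩ := Nat.exists_eq_succ_of_ne_zero (pow_pos hp.pos m).ne'
      rw [hj]
      exact e.2.1.pow_succ_eq j
    · exact Subtype.ext e.2.1
    · exact congrArg Subtype.val e.2
    · exact ((mem_frobeniusInversionFixed hp hF _).1 e.1.2).2
  · rintro ⟨x, hx⟩
    rw [hF]
    exact Subtype.ext ((mem_frobeniusInversionFixed hp hF x).1 hx).1

end Orbits

/-! ### Counting the orbits by additive order. -/

section OrbitCount

theorem natCard_orbitRel_quotient_eq_sum (K X : Type*) [Group K] [MulAction K X] [Fintype X] :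
    (Nat.card (MulAction.orbitRel.Quotient K X) : ℝ) =
      ∑ a : X, (1 : ℝ) / Nat.card (MulAction.orbit K a) := by
  classical
  have : Fintype (MulAction.orbitRel.Quotient K X) := Fintype.ofFinite _
  have : ∀ ω : MulAction.orbitRel.Quotient K X, Fintype ω.orbit := fun _ => Fintype.ofFinite _
  rw [← (MulAction.selfEquivSigmaOrbits' K X).symm.sum_comp, Fintype.sum_sigma]
  have h1 : ∀ ω : MulAction.orbitRel.Quotient K X, ∑ a : ω.orbit,
      (1 : ℝ) / Nat.card (MulAction.orbit K
        ((MulAction.selfEquivSigmaOrbits' K X).symm ⟨ω, a⟩)) = 1 := by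
    intro ω
    have h2 : ∀ a : ω.orbit, MulAction.orbit K
        ((MulAction.selfEquivSigmaOrbits' K X).symm ⟨ω, a⟩) = ω.orbit := by
      intro a
      rw [MulAction.orbitRel.Quotient.orbit_eq_orbit_out ω Quotient.out_eq',
        MulAction.orbit_eq_iff,
        ← MulAction.orbitRel.Quotient.orbit_eq_orbit_out ω Quotient.out_eq']
      exact a.2
    simp only [h2]
    have h3 : (Nat.card ω.orbit : ℝ) ≠ 0 := by
      have : Nonempty ω.orbit :=
        (MulAction.orbitRel.Quotient.nonempty_orbit ω).to_subtype
      exact_mod_cast Nat.card_pos.ne'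
    rw [Finset.sum_const, Finset.card_univ, ← Nat.card_eq_fintype_card, nsmul_eq_mul,
      mul_one_div_cancel h3]
  rw [Finset.sum_congr rfl fun ω _ => h1 ω]
  simp only [Finset.sum_const, Finset.card_univ, Nat.card_eq_fintype_card, nsmul_eq_mul,
    mul_one]

theorem signedPowers_map_unitsMap {q N d : ℕ} (h : q.Coprime N) (hd : d ∣ N) :
    (signedPowers h).map (ZMod.unitsMap hd) = signedPowers (h.coprime_dvd_right hd) := by
  rw [signedPowers, signedPowers, Subgroup.map_sup, MonoidHom.map_zpowers, MonoidHom.map_zpowers]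
  congr 2
  · ext
    simp [ZMod.unitsMap]
  · ext
    simp [ZMod.unitsMap]

/-- A unit `u` fixes `a` iff `d` divides `u - 1`, so the stabilizer is the kernel of reduction to
`(ℤ/d)ˣ`, and the orbit is as large as the image. -/
theorem natCard_orbit_signedPowers {q N : ℕ} [NeZero N] (h : q.Coprime N) (a : ZMod N) {d : ℕ}
    (hd : d ∣ N) (ha : addOrderOf a = d) :
    Nat.card (MulAction.orbit (signedPowers h) a) =
      Nat.card (signedPowers (h.coprime_dvd_right hd)) := by
  have hstab : MulAction.stabilizer (signedPowers h) a =
      ((ZMod.unitsMap hd).comp (signedPowers h).subtype).ker := by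
    ext ⟨u, hu⟩
    rw [MulAction.mem_stabilizer_iff, MonoidHom.mem_ker]
    change (u : ZMod N) * a = a ↔ ZMod.unitsMap hd u = 1
    rw [Units.ext_iff, Units.val_one, ← sub_eq_zero, ← sub_one_mul,
      ← sub_eq_zero (b := (1 : ZMod d))]
    have h1 : ((ZMod.unitsMap hd u : (ZMod d)ˣ) : ZMod d) - 1 =
        ZMod.castHom hd (ZMod d) ((u : ZMod N) - 1) := by
      rw [map_sub, map_one]
      rfl
    rw [h1]
    obtain ⟨z, hz⟩ := ZMod.intCast_surjective ((u : ZMod N) - 1)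
    rw [← hz, map_intCast, ZMod.intCast_zmod_eq_zero_iff_dvd, ← ha,
      addOrderOf_dvd_iff_zsmul_eq_zero, zsmul_eq_mul]
  rw [Nat.card_coe_set_eq, ← MulAction.index_stabilizer, hstab, Subgroup.index_ker, ← signedPowers_map_unitsMap h hd,
    MonoidHom.range_comp, Subgroup.range_subtype]

theorem isGoodInteger_iff_neg_one_mem {q d : ℕ} [NeZero d] (h : q.Coprime d) :
    IsGoodInteger q 1 d ↔ -1 ∈ Subgroup.zpowers (ZMod.unitOfCoprime q h) := by
  have key : ∀ k : ℕ, (d : ℤ) ∣ (q : ℤ) ^ k + 1 ^ k ↔ ZMod.unitOfCoprime q h ^ k = -1 := by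
    intro k
    rw [← ZMod.intCast_zmod_eq_zero_iff_dvd, Units.ext_iff]
    push_cast
    rw [ZMod.coe_unitOfCoprime, one_pow, add_eq_zero_iff_eq_neg]
  constructor
  · rintro ⟨-, k, -, hk⟩
    exact ⟨k, by simpa using (key k).1 hk⟩
  · intro hmem
    obtain ⟨k, hk⟩ := mem_powers_iff_mem_zpowers.2 hmem
    -- Goodness needs a positive exponent and `k` may be `0`, so one full period is added.
    refine ⟨Nat.pos_of_ne_zero (NeZero.ne d), k + orderOf (ZMod.unitOfCoprime q h),
      Nat.add_pos_right _ (orderOf_pos _), (key _).2 ?_⟩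
    rw [pow_add, pow_orderOf_eq_one, mul_one]
    exact hk

theorem orderOf_unitOfCoprime {q d : ℕ} (h : q.Coprime d) :
    orderOf (ZMod.unitOfCoprime q h) = orderOf (q : ZMod d) := by
  rw [← orderOf_units, ZMod.coe_unitOfCoprime]

theorem natCard_signedPowers_of_good {q d : ℕ} [NeZero d] (h : q.Coprime d)
    (hg : IsGoodInteger q 1 d) : Nat.card (signedPowers h) = orderOf (q : ZMod d) := by
  rw [isGoodInteger_iff_neg_one_mem h, ← Subgroup.zpowers_le] at hg
  rw [signedPowers, sup_eq_left.2 hg, Nat.card_zpowers, orderOf_unitOfCoprime]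

theorem natCard_signedPowers_of_bad {q d : ℕ} [NeZero d] (h : q.Coprime d)
    (hg : ¬ IsGoodInteger q 1 d) : Nat.card (signedPowers h) = 2 * orderOf (q : ZMod d) := by
  rw [isGoodInteger_iff_neg_one_mem h] at hg
  have hne : (-1 : (ZMod d)ˣ) ≠ 1 := fun h1 => hg (by rw [h1]; exact one_mem _)
  have hinf : Subgroup.zpowers (ZMod.unitOfCoprime q h) ⊓ Subgroup.zpowers (-1) = ⊥ := by
    rw [eq_bot_iff]
    rintro y ⟨hy, k, rfl⟩
    rcases Int.even_or_odd k with hk | hk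
    · simp [hk.neg_one_zpow]
    · refine absurd ?_ hg
      simpa [hk.neg_one_zpow] using hy
  have h2 : orderOf (-1 : (ZMod d)ˣ) = 2 := orderOf_eq_prime (by simp) hne
  -- By the second isomorphism theorem, `⟨q⟩` has the same index in the join as `⟨q⟩ ⊓ ⟨-1⟩ = ⊥` has
  -- in `⟨-1⟩`, namely 2.
  have h3 := Subgroup.relIndex_mul_relIndex ⊥ (Subgroup.zpowers (ZMod.unitOfCoprime q h))
    (signedPowers h) bot_le le_sup_left
  rw [Subgroup.relIndex_bot_left, Subgroup.relIndex_bot_left, signedPowers, sup_comm,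
    Subgroup.relIndex_sup_right, ← Subgroup.inf_relIndex_right, hinf, Subgroup.relIndex_bot_left,
    Nat.card_zpowers, Nat.card_zpowers, h2, orderOf_unitOfCoprime] at h3
  rw [signedPowers, sup_comm, ← h3, mul_comm]

theorem natCard_orbits_signedPowers {q N : ℕ} [NeZero N] (h : q.Coprime N)
    [DecidablePred (IsGoodInteger (q : ℤ) 1)] :
    (Nat.card (MulAction.orbitRel.Quotient (signedPowers h) (ZMod N)) : ℝ) =
      (∑ d ∈ N.divisors with IsGoodInteger q 1 d,
        (Nat.totient d : ℝ) / (orderOf (q : ZMod d) : ℝ)) +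
      ∑ d ∈ N.divisors with ¬ IsGoodInteger q 1 d,
        (Nat.totient d : ℝ) / (2 * (orderOf (q : ZMod d) : ℝ)) := by
  rw [natCard_orbitRel_quotient_eq_sum, Finset.sum_filter, Finset.sum_filter,
    ← Finset.sum_add_distrib]
  have hmaps : ∀ a ∈ (Finset.univ : Finset (ZMod N)), addOrderOf a ∈ N.divisors := by
    intro a _
    rw [Nat.mem_divisors]
    refine ⟨?_, NeZero.ne N⟩
    have := addOrderOf_dvd_card (x := a)
    rwa [ZMod.card] at this
  rw [← Finset.sum_fiberwise_of_maps_to hmaps]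
  refine Finset.sum_congr rfl fun d hd => ?_
  have hdN := Nat.dvd_of_mem_divisors hd
  have : NeZero d := ⟨(Nat.pos_of_mem_divisors hd).ne'⟩
  have h1 : ∀ a ∈ (Finset.univ : Finset (ZMod N)).filter (fun a => addOrderOf a = d),
      (1 : ℝ) / Nat.card (MulAction.orbit (signedPowers h) a) =
        1 / Nat.card (signedPowers (h.coprime_dvd_right hdN)) := by
    intro a ha
    rw [natCard_orbit_signedPowers h a hdN (Finset.mem_filter.1 ha).2]
  rw [Finset.sum_congr rfl h1, Finset.sum_const,
    IsAddCyclic.card_addOrderOf_eq_totient (by rwa [ZMod.card]), nsmul_eq_mul, mul_one_div]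
  by_cases hg : IsGoodInteger q 1 d
  · simp [hg, natCard_signedPowers_of_good _ hg]
  · simp [hg, natCard_signedPowers_of_bad _ hg]

end OrbitCount

/-! ### The counting formula. -/

open scoped Classical in
theorem theorem4 (p m n N t : ℕ) (hp : p.Prime) (hm : 0 < m) (hn : 0 < n)
    (hnN : n = N * p ^ t) (hpN : ¬ p ∣ N)
    (F : Type*) [Field F] (hF : Nat.card F = p ^ m) :
    (Set.ncard {C : Submodule F (Fin n → F) |
        IsCyclicCode C ∧ IsEuclideanComplementaryDual C} : ℝ) =
      (2 : ℝ) ^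
        ((∑ d ∈ N.divisors with IsGoodInteger ((p : ℤ) ^ m) 1 d,
            (Nat.totient d : ℝ) / (orderOf ((p : ZMod d) ^ m) : ℝ)) +
          ∑ d ∈ N.divisors with ¬ IsGoodInteger ((p : ℤ) ^ m) 1 d,
            (Nat.totient d : ℝ) / (2 * (orderOf ((p : ZMod d) ^ m) : ℝ))) := by
  have hN : N ≠ 0 := by
    rintro rfl
    exact hpN (dvd_zero p)
  have : NeZero N := ⟨hN⟩
  have hcop : (p ^ m).Coprime N := Nat.Coprime.pow_left m ((hp.coprime_iff_not_dvd).2 hpN)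
  have hcount : Set.ncard {C : Submodule F (Fin n → F) |
      IsCyclicCode C ∧ IsEuclideanComplementaryDual C} =
      2 ^ Nat.card (MulAction.orbitRel.Quotient (signedPowers hcop) (ZMod N)) := by
    rw [← natCard_invariant_idempotent_eq_two_pow hp hF hcop,
      ← natCard_invariant_idempotent_zmod hp hm hF hn hnN]
    obtain ⟨k, rfl⟩ := Nat.exists_eq_succ_of_ne_zero hn.ne'
    exact ncard_lcdCyclicCode
  have hexp := natCard_orbits_signedPowers hcop
  simp only [Nat.cast_pow] at hexp
  rw [← hexp, hcount, Real.rpow_natCast]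
  push_cast
  rfl
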